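/- Let $(\mathcal C,J)$ be a small site, let $\mathcal E=\mathrm{Sh}(\mathcal C,J)$ be its topos of sheaves of sets, let $\mathcal F$ be a Grothendieck topos (a category equivalent to the category of sheaves of sets on some small site), and let $f:\mathcal F\to\mathcal E$ be a geometric morphism, i.e. a functor $f_*:\mathcal F\to\mathcal E$ with a left adjoint $f^*:\mathcal E\to\mathcal F$ that preserves finite limits. For a topos $\mathcal T$ let $\mathrm{Ab}(\mathcal T)$ be the abelian category of abelian group objects in $\mathcal T$. Let $R^qf_*:\mathrm{Ab}(\mathcal F)\to\mathrm{Ab}(\mathcal E)$ be the $q$-th right derived functor of the functor $f_*:\mathrm{Ab}(\mathcal F)\to\mathrm{Ab}(\mathcal E)$ induced by $f_*$, and for an object $B$ of $\mathcal F$ let $H^q(\mathcal F,B;-)$ be the $q$-th right derived functor of $\mathrm{Hom}_{\mathcal F}(B,-):\mathrm{Ab}(\mathcal F)\to\mathrm{Ab}$; it is contravariantly functorial in $B$. Let $l:\mathcal C\to\mathrm{Sh}(\mathcal C,J)$ be the canonical functor sending $U$ to the $J$-sheaf associated to the presheaf $\mathrm{Hom}_{\mathcal C}(-,U)$. Then for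 every $q\ge 0$ and every $F\in\mathrm{Ab}(\mathcal F)$, the object $R^qf_*(F)$, regarded as a sheaf of abelian groups on $(\mathcal C,J)$ via the equivalence of $\mathrm{Ab}(\mathrm{Sh}(\mathcal C,J))$ with the category of sheaves of abelian groups, is isomorphic to the $J$-sheaf associated to the presheaf of abelian groups $U\mapsto H^q(\mathcal F,f^*l(U);F)$ on $\mathcal C$, and this isomorphism can be chosen naturally in $F$. -/

import Mathlib

universe w v u u₁

namespace ToposCohomology

open CategoryTheory Limits MonoidalCategory CartesianMonoidalCategory MonObj Opposite

/-! Abelian group objects of a category with chosen finite products: this is `CommGrp`.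
(Group objects are written multiplicatively by Mathlib, hence the `Additive` below.) -/

section Preadd
variable {F : Type u} [Category.{v} F] [CartesianMonoidalCategory F] [BraidedCategory F]

/-- The group of homomorphisms between two abelian group objects,
with the operation induced by the group law of the target. -/
instance homAddCommGroup (A B : CommGrp F) : AddCommGroup (A ⟶ B) :=
  letI e : (A ⟶ B) ≃ Additive (A.toGrp ⟶ B.toGrp) :=
    InducedCategory.homEquiv.trans Additive.ofMul
  e.addCommGroup

theorem add_hom (A B : CommGrp F) (f g : A ⟶ B) :
    (f + g).hom.hom.hom = f.hom.hom.hom * g.hom.hom.hom := rfl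

instance preadditiveCommGrp : Preadditive (CommGrp F) where
  add_comp A B D f g h := by
    apply CommGrp.hom_ext
    simp [add_hom, MonObj.mul_comp]
  comp_add A B D f g h := by
    apply CommGrp.hom_ext
    simp [add_hom, MonObj.comp_mul]

/-- The functor `Hom(B, -)` from abelian group objects to abelian groups. -/
@[simps]
def homFunctor (B : F) : CommGrp F ⥤ AddCommGrpCat.{v} where
  obj A := AddCommGrpCat.of (Additive (B ⟶ A.X))
  map {A A'} φ := AddCommGrpCat.ofHom
    { toFun := fun s => Additive.ofMul (s.toMul ≫ φ.hom.hom.hom)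
      map_zero' := by
        apply Additive.toMul.injective
        simp
      map_add' := fun s t => by
        apply Additive.toMul.injective
        simp [MonObj.mul_comp] }
  map_id A := by ext s; simp
  map_comp φ ψ := by ext s; simp

instance (B : F) : (homFunctor B).Additive where
  map_add {A A' f g} := by
    ext s
    exact congrArg Additive.ofMul (MonObj.comp_mul s.toMul f.hom.hom.hom g.hom.hom.hom)

/-- Contravariant functoriality of `Hom(B, -)` in the object `B`. -/
@[simps]
def homFunctorMap {B B' : F} (b : B' ⟶ B) : homFunctor B ⟶ homFunctor B' where
  app A := AddCommGrpCat.ofHom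
    { toFun := fun s => Additive.ofMul (b ≫ s.toMul)
      map_zero' := by
        apply Additive.toMul.injective
        simp
      map_add' := fun s t => by
        apply Additive.toMul.injective
        simp [MonObj.comp_mul] }
  naturality A A' φ := by
    ext s
    exact congrArg Additive.ofMul (Category.assoc b s.toMul φ.hom.hom.hom).symm

end Preadd

section Sheaves
variable {C : Type w} [SmallCategory C] {J : GrothendieckTopology C}

/-- The finite products of sheaves of sets (so that instance search finds those of the
cartesian structure). -/
instance sheafMonoidalCategory : MonoidalCategory (Sheaf J (Type w)) :=
  SemiCartesianMonoidalCategory.toMonoidalCategory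

instance sheafBraidedCategory : BraidedCategory (Sheaf J (Type w)) :=
  .ofCartesianMonoidalCategory

theorem sheafHom_congr {Y X : Sheaf J (Type w)} {f g : Y ⟶ X} (h : f = g) {U : Cᵒᵖ}
    (y : Y.obj.obj U) : f.hom.app U y = g.hom.app U y := by rw [h]

theorem sheafHom_map {Y X : Sheaf J (Type w)} (f : Y ⟶ X) {U V : Cᵒᵖ} (i : U ⟶ V)
    (y : Y.obj.obj U) : f.hom.app V (Y.obj.map i y) = X.obj.map i (f.hom.app U y) :=
  NatTrans.naturality_apply f.hom i y

/-- The abelian group `A(U)` of sections of an abelian group object `A` in sheaves of sets. -/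
abbrev sectionsAddCommGroup (A : CommGrp (Sheaf J (Type w))) (U : Cᵒᵖ) :
    AddCommGroup (A.X.obj.obj U) :=
  letI : Add (A.X.obj.obj U) := ⟨fun x y => μ[A.X].hom.app U (x, y)⟩
  letI : Zero (A.X.obj.obj U) := ⟨η[A.X].hom.app U PUnit.unit⟩
  letI : Neg (A.X.obj.obj U) := ⟨fun x => ι[A.X].hom.app U x⟩
  { AddGroup.ofLeftAxioms
      (fun x y z => sheafHom_congr (MonObj.mul_assoc A.X) (U := U) (show _ from ((x, y), z)))
      (fun x => sheafHom_congr (MonObj.one_mul A.X) (U := U) (show _ from (PUnit.unit, x)))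
      (fun x => sheafHom_congr (GrpObj.left_inv A.X) (U := U) x) with
    add_comm := fun x y =>
      sheafHom_congr (IsCommMonObj.mul_comm A.X) (U := U) (show _ from (y, x)) }

attribute [local instance] sectionsAddCommGroup

/-- The presheaf of abelian groups `U ↦ A(U)`. -/
def abPresheafObj (A : CommGrp (Sheaf J (Type w))) : Cᵒᵖ ⥤ AddCommGrpCat.{w} where
  obj U := AddCommGrpCat.of (A.X.obj.obj U)
  map {U V} i := AddCommGrpCat.ofHom
    (AddMonoidHom.mk' (fun x : A.X.obj.obj U => A.X.obj.map i x) fun x y =>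
      (sheafHom_map μ[A.X] i (show _ from (x, y))).symm)
  map_id U := by
    ext x
    exact ConcreteCategory.congr_hom (A.X.obj.map_id U) x
  map_comp i j := by
    ext x
    exact ConcreteCategory.congr_hom (A.X.obj.map_comp i j) x

/-- The presheaf of sets underlying `U ↦ A(U)` is `A`. -/
def abPresheafObjForget (A : CommGrp (Sheaf J (Type w))) :
    abPresheafObj A ⋙ forget AddCommGrpCat.{w} ≅ A.X.obj :=
  NatIso.ofComponents (fun _ => Iso.refl _) (fun _ => rfl)

/-- An abelian group object `A` of the category of sheaves of sets on `(C, J)`,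
viewed as the sheaf of abelian groups `U ↦ A(U)`. This is an equivalence of categories. -/
def toAbSheaf (J : GrothendieckTopology C) :
    CommGrp (Sheaf J (Type w)) ⥤ Sheaf J AddCommGrpCat.{w} where
  obj A :=
    { obj := abPresheafObj A
      property := (Presheaf.isSheaf_iff_isSheaf_forget J _ (forget AddCommGrpCat.{w})).2
        ((Presheaf.isSheaf_of_iso_iff (abPresheafObjForget A)).2 A.X.property) }
  map {A B} φ := ⟨
    { app := fun U => AddCommGrpCat.ofHom
        (AddMonoidHom.mk' (fun x : A.X.obj.obj U => φ.hom.hom.hom.hom.app U x) fun x y =>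
          sheafHom_congr (IsMonHom.mul_hom φ.hom.hom.hom) (U := U) (show _ from (x, y)))
      naturality := fun U V i => by
        ext x
        exact NatTrans.naturality_apply φ.hom.hom.hom.hom i x }⟩
  map_id A := rfl
  map_comp φ ψ := rfl

instance : (toAbSheaf J).Faithful where
  map_injective {A B φ ψ} h := by
    apply CommGrp.hom_ext
    ext U x
    have h' : ((toAbSheaf J).map φ).hom.app U = ((toAbSheaf J).map ψ).hom.app U := by rw [h]
    exact ConcreteCategory.congr_hom h' x

instance : (toAbSheaf J).Full where
  map_surjective {A B} φ := by
    let g : A.X ⟶ B.X := ⟨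
      { app := fun U => ↾(fun x => φ.hom.app U x)
        naturality := fun U V i => by
          ext x
          exact NatTrans.naturality_apply φ.hom i x }⟩
    have : IsMonHom g :=
      { one_hom := by
          ext U x
          exact map_zero (φ.hom.app U).hom
        mul_hom := by
          ext U x
          exact map_add (φ.hom.app U).hom x.1 x.2 }
    exact ⟨InducedCategory.homMk (Grp.homMk'' g), rfl⟩

/-- Sheaf of sets underlying a sheaf of abelian groups. -/
def underlyingSheaf (G : Sheaf J AddCommGrpCat.{w}) : Sheaf J (Type w) :=
  (sheafCompose J (forget AddCommGrpCat.{w})).obj G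

/-- The sectionwise group law of a sheaf of abelian groups. -/
abbrev underlyingGrpObj (G : Sheaf J AddCommGrpCat.{w}) : GrpObj (underlyingSheaf G) where
  one := ⟨{ app := fun U => ↾(fun _ => (0 : G.obj.obj U))
            naturality := fun U V i => by
              ext x
              exact (map_zero (G.obj.map i).hom).symm }⟩
  mul := ⟨{ app := fun U => ↾(fun x => (show G.obj.obj U from x.1) + (show G.obj.obj U from x.2))
            naturality := fun U V i => by
              ext x
              exact (map_add (G.obj.map i).hom _ _).symm }⟩
  inv := ⟨{ app := fun U => ↾(fun x => -(show G.obj.obj U from x))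
            naturality := fun U V i => by
              ext x
              exact (map_neg (G.obj.map i).hom _).symm }⟩
  one_mul := by
    ext U x
    exact zero_add (show G.obj.obj U from x.2)
  mul_one := by
    ext U x
    exact add_zero (show G.obj.obj U from x.1)
  mul_assoc := by
    ext U x
    exact add_assoc (show G.obj.obj U from x.1.1) (show G.obj.obj U from x.1.2)
      (show G.obj.obj U from x.2)
  left_inv := by
    ext U x
    exact neg_add_cancel (show G.obj.obj U from x)
  right_inv := by
    ext U x
    exact add_neg_cancel (show G.obj.obj U from x)

/-- A sheaf of abelian groups as an abelian group object in sheaves of sets. -/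
def underlyingCommGrp (G : Sheaf J AddCommGrpCat.{w}) : CommGrp (Sheaf J (Type w)) :=
  letI := underlyingGrpObj G
  { X := underlyingSheaf G
    comm :=
      { mul_comm := by
          ext U x
          exact add_comm (show G.obj.obj U from x.2) (show G.obj.obj U from x.1) } }

instance : (toAbSheaf J).EssSurj where
  mem_essImage G := ⟨underlyingCommGrp G, ⟨(fullyFaithfulSheafToPresheaf J _).preimageIso
    (NatIso.ofComponents (fun U => AddEquiv.toAddCommGrpIso
      { Equiv.refl (G.obj.obj U) with map_add' := fun _ _ => rfl }) (fun _ => rfl))⟩⟩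

instance : (toAbSheaf J).IsEquivalence where
end Sheaves

/-- A Grothendieck topos: a category equivalent to `Sh(C, J)` for some small site `(C, J)`. -/
class IsGrothendieckTopos (F : Type u) [Category.{w} F] : Prop where
  exists_site : ∃ (C : Type w) (_ : SmallCategory C) (J : GrothendieckTopology C),
    Nonempty (F ≌ Sheaf J (Type w))

instance {C : Type w} [SmallCategory C] (J : GrothendieckTopology C) :
    IsGrothendieckTopos (Sheaf J (Type w)) where
  exists_site := ⟨C, _, J, ⟨CategoryTheory.Equivalence.refl⟩⟩

section Topos
variable (F : Type u) [Category.{w} F] [CartesianMonoidalCategory F] [BraidedCategory F]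
  [IsGrothendieckTopos F]

theorem exists_isEquivalence : ∃ (C : Type w) (_ : SmallCategory C) (J : GrothendieckTopology C)
    (Φ : CommGrp F ⥤ Sheaf J AddCommGrpCat.{w}), Φ.IsEquivalence := by
  obtain ⟨C, _, J, ⟨e⟩⟩ := IsGrothendieckTopos.exists_site (F := F)
  let _ := Functor.Braided.ofChosenFiniteProducts e.functor
  let _ := Functor.Braided.ofChosenFiniteProducts e.inverse
  exact ⟨C, _, J, e.mapCommGrp.functor ⋙ toAbSheaf J, inferInstance⟩

/-- `Ab(F)` is an abelian category; the group structure on morphisms is the canonical one. -/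
noncomputable instance abelianCommGrp : Abelian (CommGrp F) :=
  letI := (exists_isEquivalence F).choose_spec.choose
  letI Φ := (exists_isEquivalence F).choose_spec.choose_spec.choose_spec.choose
  haveI : Φ.IsEquivalence :=
    (exists_isEquivalence F).choose_spec.choose_spec.choose_spec.choose_spec
  haveI : HasFiniteProducts (CommGrp F) :=
    ⟨fun _ => Adjunction.hasLimitsOfShape_of_equivalence Φ⟩
  abelianOfEquivalence Φ

/-- `Ab(F)` has enough injectives, so that right derived functors are defined on it. -/
instance enoughInjectivesCommGrp : EnoughInjectives (CommGrp F) := by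
  obtain ⟨C, _, J, Φ, _⟩ := exists_isEquivalence F
  exact EnoughInjectives.of_equivalence Φ

end Topos

/-- A geometric morphism `F ⟶ E`: a direct image functor with a left exact left adjoint. -/
structure GeometricMorphism (F : Type u) [Category.{v} F] (E : Type u₁) [Category.{w} E] where
  directImage : F ⥤ E
  inverseImage : E ⥤ F
  adj : inverseImage ⊣ directImage
  preservesFiniteLimits_inverseImage : PreservesFiniteLimits inverseImage

namespace GeometricMorphism
section
variable {F : Type u} [Category.{v} F] [CartesianMonoidalCategory F] [BraidedCategory F]
  {E : Type u₁} [Category.{w} E] [CartesianMonoidalCategory E] [BraidedCategory E]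
  (f : GeometricMorphism F E)

/-- The direct image functor preserves finite products, being a right adjoint. -/
noncomputable instance : f.directImage.Braided :=
  haveI : PreservesLimitsOfSize.{0, 0} f.directImage := f.adj.rightAdjoint_preservesLimits
  .ofChosenFiniteProducts _

/-- The functor `f_* : Ab(F) ⥤ Ab(E)` induced by the direct image functor. -/
noncomputable def abDirectImage : CommGrp F ⥤ CommGrp E := f.directImage.mapCommGrp

instance : f.abDirectImage.Additive where
  map_add {A B φ ψ} := by
    apply CommGrp.hom_ext
    exact Functor.map_mul f.directImage φ.hom.hom.hom ψ.hom.hom.hom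
end

section
variable {F : Type u} [Category.{w} F] [CartesianMonoidalCategory F] [BraidedCategory F]
  [IsGrothendieckTopos F]
  {E : Type u₁} [Category.{w} E] [CartesianMonoidalCategory E] [BraidedCategory E]
  [IsGrothendieckTopos E] (f : GeometricMorphism F E)

/-- The higher direct image `R^q f_* : Ab(F) ⥤ Ab(E)`. -/
noncomputable def higherDirectImage (q : ℕ) : CommGrp F ⥤ CommGrp E :=
  f.abDirectImage.rightDerived q
end
end GeometricMorphism

section
variable (F : Type u) [Category.{w} F] [CartesianMonoidalCategory F] [BraidedCategory F]
  [IsGrothendieckTopos F]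

/-- `(B, A) ↦ H^q(F, B; A)`, the `q`-th right derived functor of `Hom(B, -)` on `Ab(F)`,
with its contravariant functoriality in `B`. -/
noncomputable def cohomology (q : ℕ) : Fᵒᵖ ⥤ CommGrp F ⥤ AddCommGrpCat.{w} where
  obj B := (homFunctor B.unop).rightDerived q
  map b := NatTrans.rightDerived (homFunctorMap b.unop) q
  map_id B := by
    rw [← NatTrans.rightDerived_id]
    congr 1
    ext A s
    exact congrArg Additive.ofMul (Category.id_comp s.toMul)
  map_comp b b' := by
    rw [← NatTrans.rightDerived_comp]
    congr 1
    ext A s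
    exact congrArg Additive.ofMul (Category.assoc b'.unop b.unop s.toMul)

end

/-- The canonical functor `l : C ⥤ Sh(C, J)`, sending `U` to the sheaf associated to
`Hom(-, U)`. -/
noncomputable def canonicalFunctor {C : Type w} [SmallCategory C] (J : GrothendieckTopology C) :
    C ⥤ Sheaf J (Type w) :=
  yoneda ⋙ presheafToSheaf J (Type w)

/-- The presheaf of abelian groups `U ↦ H^q(F, f^* l(U); A)` on `C`, functorially in `A`. -/
noncomputable def GeometricMorphism.cohomologyPresheaf
    {F : Type u} [Category.{w} F] [CartesianMonoidalCategory F] [BraidedCategory F]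
    [IsGrothendieckTopos F] {C : Type w} [SmallCategory C] {J : GrothendieckTopology C}
    (f : GeometricMorphism F (Sheaf J (Type w))) (q : ℕ) :
    CommGrp F ⥤ Cᵒᵖ ⥤ AddCommGrpCat.{w} :=
  ((canonicalFunctor J ⋙ f.inverseImage).op ⋙ cohomology F q).flip

end ToposCohomology

open CategoryTheory ToposCohomology

/-!
Since exact functors commute with homology, postcomposition with an exact functor commutes with
taking right derived functors of additive functors on `Ab(F)` (`rightDerivedCompIso`). Three
instances of this reduce the claim to degree zero.

* In degree zero, the adjunctions `f^* ⊣ f_*` and sheafification `⊣` inclusion, together with the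
  Yoneda lemma, identify the group of sections of `f_* A` over `U` with `Hom(f^* l(U), A)`
  (`sectionsIso`). Hence the sheaf of abelian groups `f_* A` is the sheafification of the presheaf
  `U ↦ Hom(f^* l(U), A)`.
* The equivalence `toAbSheaf J` is exact, so the functor `A ↦ R^q f_* A`, read in sheaves of abelian
  groups, is the `q`-th right derived functor of `A ↦ f_* A` read there.
* Sheafification is exact, so this is the sheafification of the `q`-th right derived functor of
  `A ↦ (U ↦ Hom(f^* l(U), A))`, a functor with values in presheaves.
* Evaluation of presheaves at `U` is exact, so that derived functor has the value
  `H^q(F, f^* l(U); A)` at `U` (`rightDerivedHomPresheaf`). Compatibility with restriction maps is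
  the naturality of `rightDerivedCompIso` in the exact functor
  (`rightDerivedCompIso_hom_whiskerLeft`).
-/

/-! ### Right derived functors and exact functors -/

namespace CategoryTheory
open Limits

section ExactFunctors
variable {C : Type*} [Category* C] {D : Type*} [Category* D] {E : Type*} [Category* E]
  [Abelian C] [Abelian D] [Abelian E]

/-- An exact functor `H` commutes with homology: for a complex `K` and an additive functor `G`,
the homology of `H(G(K))` is `H` applied to the homology of `G(K)`. -/
noncomputable def homologyCompIso (G : C ⥤ D) [G.Additive] (H : D ⥤ E) [H.Additive]
    [H.PreservesHomology] (K : CochainComplex C ℕ) (n : ℕ) :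
    (HomologicalComplex.homologyFunctor E _ n).obj (((G ⋙ H).mapHomologicalComplex _).obj K) ≅
      H.obj ((HomologicalComplex.homologyFunctor D _ n).obj
        ((G.mapHomologicalComplex _).obj K)) :=
  (((G.mapHomologicalComplex _).obj K).sc n).mapHomologyIso H

lemma homologyCompIso_hom_naturality (G : C ⥤ D) [G.Additive] (H : D ⥤ E) [H.Additive]
    [H.PreservesHomology] {K L : CochainComplex C ℕ} (φ : K ⟶ L) (n : ℕ) :
    ((G ⋙ H).mapHomologicalComplex _ ⋙ HomologicalComplex.homologyFunctor E _ n).map φ ≫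
        (homologyCompIso G H L n).hom =
      (homologyCompIso G H K n).hom ≫
        H.map ((G.mapHomologicalComplex _ ⋙ HomologicalComplex.homologyFunctor D _ n).map φ) :=
  ShortComplex.mapHomologyIso_hom_naturality
    ((HomologicalComplex.shortComplexFunctor _ _ n).map ((G.mapHomologicalComplex _).map φ)) H

lemma homologyCompIso_hom_whiskerLeft (G : C ⥤ D) [G.Additive] {H H' : D ⥤ E} [H.Additive]
    [H'.Additive] [H.PreservesHomology] [H'.PreservesHomology] (β : H ⟶ H')
    (K : CochainComplex C ℕ) (n : ℕ) :
    (HomologicalComplex.homologyFunctor E _ n).map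
        ((NatTrans.mapHomologicalComplex (Functor.whiskerLeft G β) _).app K) ≫
        (homologyCompIso G H' K n).hom =
      (homologyCompIso G H K n).hom ≫ β.app _ := by
  have h := ShortComplex.homologyMap_mapNatTrans (((G.mapHomologicalComplex _).obj K).sc n) β
  exact (Iso.eq_comp_inv _).1 (h.trans (Category.assoc _ _ _).symm)

variable [HasInjectiveResolutions C]

/-- Right derived functors commute with postcomposition by an exact functor. The components are
computed on the chosen injective resolutions. -/
noncomputable def rightDerivedCompIso (G : C ⥤ D) [G.Additive] (H : D ⥤ E) [H.Additive]
    [H.PreservesHomology] (n : ℕ) :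
    (G ⋙ H).rightDerived n ≅ G.rightDerived n ⋙ H :=
  NatIso.ofComponents (fun X =>
    (injectiveResolution X).isoRightDerivedObj (G ⋙ H) n ≪≫ homologyCompIso G H _ n ≪≫
      H.mapIso ((injectiveResolution X).isoRightDerivedObj G n).symm) (by
    intro X Y f
    have h := InjectiveResolution.desc_commutes f (injectiveResolution Y) (injectiveResolution X)
    rw [Functor.rightDerived_map_eq (G ⋙ H) n f _ h]
    rw [Functor.comp_map (F := G.rightDerived n), Functor.rightDerived_map_eq G n f _ h]
    simp only [Iso.trans_hom, Functor.mapIso_hom, Iso.symm_hom, Category.assoc,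
      Iso.inv_hom_id_assoc]
    simp only [← Functor.map_comp, Iso.inv_hom_id_assoc]
    rw [Functor.map_comp]
    congr 1
    exact (reassoc_of% homologyCompIso_hom_naturality G H _ n) _)

/-- Naturality of `rightDerivedCompIso` in the exact functor. -/
lemma rightDerivedCompIso_hom_whiskerLeft (G : C ⥤ D) [G.Additive] {H H' : D ⥤ E} [H.Additive]
    [H'.Additive] [H.PreservesHomology] [H'.PreservesHomology] (β : H ⟶ H') (n : ℕ) :
    NatTrans.rightDerived (Functor.whiskerLeft G β) n ≫ (rightDerivedCompIso G H' n).hom =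
      (rightDerivedCompIso G H n).hom ≫ Functor.whiskerLeft _ β := by
  ext X
  rw [NatTrans.comp_app, NatTrans.comp_app,
    (injectiveResolution X).rightDerived_app_eq (Functor.whiskerLeft G β)]
  have h := homologyCompIso_hom_whiskerLeft G β (injectiveResolution X).cocomplex n
  simp only [rightDerivedCompIso, NatIso.ofComponents_hom_app, Iso.trans_hom, Functor.mapIso_hom,
    Iso.symm_hom, Category.assoc, Iso.inv_hom_id_assoc, reassoc_of% h,
    Functor.whiskerLeft_app, NatTrans.naturality]

/-- A natural isomorphism of additive functors induces one of right derived functors. -/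
noncomputable def rightDerivedCongr {G G' : C ⥤ D} [G.Additive] [G'.Additive] (e : G ≅ G')
    (n : ℕ) : G.rightDerived n ≅ G'.rightDerived n where
  hom := NatTrans.rightDerived e.hom n
  inv := NatTrans.rightDerived e.inv n
  hom_inv_id := by rw [← NatTrans.rightDerived_comp, e.hom_inv_id, NatTrans.rightDerived_id]
  inv_hom_id := by rw [← NatTrans.rightDerived_comp, e.inv_hom_id, NatTrans.rightDerived_id]

end ExactFunctors
end CategoryTheory

namespace ToposCohomology

open CategoryTheory Limits MonoidalCategory CartesianMonoidalCategory MonObj Opposite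

/-! ### Sections of a sheaf as morphisms from the sheaves `l(U)` -/

section Sheaves
variable {C : Type w} [SmallCategory C] {J : GrothendieckTopology C}

instance : (toAbSheaf J).Additive where
  map_add := rfl

/-- The Yoneda lemma for sheaves: `Hom(l(U), G) ≃ G(U)`. -/
noncomputable def canonicalHomEquiv (U : C) (G : Sheaf J (Type w)) :
    ((canonicalFunctor J).obj U ⟶ G) ≃ G.obj.obj (op U) :=
  ((sheafificationAdjunction J (Type w)).homEquiv _ _).trans yonedaEquiv

lemma canonicalHomEquiv_precomp {U V : C} (i : V ⟶ U) {G : Sheaf J (Type w)}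
    (s : (canonicalFunctor J).obj U ⟶ G) :
    canonicalHomEquiv V G ((canonicalFunctor J).map i ≫ s) =
      G.obj.map i.op (canonicalHomEquiv U G s) :=
  (congrArg yonedaEquiv ((sheafificationAdjunction J (Type w)).homEquiv_naturality_left
    (yoneda.map i) s)).trans (yonedaEquiv_naturality _ i).symm

lemma canonicalHomEquiv_comp (U : C) {G G' : Sheaf J (Type w)}
    (s : (canonicalFunctor J).obj U ⟶ G) (φ : G ⟶ G') :
    canonicalHomEquiv U G' (s ≫ φ) = φ.hom.app (op U) (canonicalHomEquiv U G s) :=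
  rfl

lemma canonicalHomEquiv_mul (U : C) (G : Sheaf J (Type w)) [MonObj G]
    (s t : (canonicalFunctor J).obj U ⟶ G) :
    canonicalHomEquiv U G (s * t) =
      μ[G].hom.app (op U) (canonicalHomEquiv U G s, canonicalHomEquiv U G t) :=
  rfl

end Sheaves

section SectionsOfDirectImage
variable {F : Type u} [Category.{w} F] {C : Type w} [SmallCategory C]
  {J : GrothendieckTopology C} (f : GeometricMorphism F (Sheaf J (Type w)))

/-- `Hom(f^* l(U), X)` is the set of sections of `f_* X` over `U`. -/
noncomputable def homEquivSections (U : C) (X : F) :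
    (f.inverseImage.obj ((canonicalFunctor J).obj U) ⟶ X) ≃
      (f.directImage.obj X).obj.obj (op U) :=
  (f.adj.homEquiv _ _).trans (canonicalHomEquiv U _)

lemma homEquivSections_precomp {U V : C} (i : V ⟶ U) {X : F}
    (s : f.inverseImage.obj ((canonicalFunctor J).obj U) ⟶ X) :
    homEquivSections f V X (f.inverseImage.map ((canonicalFunctor J).map i) ≫ s) =
      (f.directImage.obj X).obj.map i.op (homEquivSections f U X s) :=
  (congrArg _ (f.adj.homEquiv_naturality_left _ s)).trans (canonicalHomEquiv_precomp i _)

lemma homEquivSections_comp (U : C) {X Y : F}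
    (s : f.inverseImage.obj ((canonicalFunctor J).obj U) ⟶ X) (φ : X ⟶ Y) :
    homEquivSections f U Y (s ≫ φ) =
      (f.directImage.map φ).hom.app (op U) (homEquivSections f U X s) :=
  (congrArg _ (f.adj.homEquiv_naturality_right s φ)).trans (canonicalHomEquiv_comp U _ _)

variable [CartesianMonoidalCategory F] [BraidedCategory F]

/-- The adjunction bijection respects the group laws because `f_*` preserves finite products and
the group law of `f_* A` is the image of that of `A`. -/
lemma homEquivSections_mul (U : C) (A : CommGrp F)
    (s t : f.inverseImage.obj ((canonicalFunctor J).obj U) ⟶ A.X) :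
    homEquivSections f U A.X (s * t) =
      μ[(f.abDirectImage.obj A).X].hom.app (op U)
        (homEquivSections f U A.X s, homEquivSections f U A.X t) := by
  refine Eq.trans (congrArg (canonicalHomEquiv U (f.abDirectImage.obj A).X)
    (a₁ := f.adj.homEquiv _ _ (s * t)) ?_)
    (canonicalHomEquiv_mul U (f.abDirectImage.obj A).X
      (f.adj.homEquiv _ _ s) (f.adj.homEquiv _ _ t))
  simp only [Adjunction.homEquiv_unit]
  exact (congrArg _ (Functor.map_mul f.directImage s t)).trans
    (MonObj.comp_mul (M := (f.abDirectImage.obj A).X) _ _ _)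

/-! ### The presheaf `U ↦ Hom(L(U), A)` -/

variable (F) in
/-- `(B, A) ↦ Hom(B, A)`, functorially in both variables. -/
def homBifunctor : Fᵒᵖ ⥤ CommGrp F ⥤ AddCommGrpCat.{w} where
  obj B := homFunctor B.unop
  map b := homFunctorMap b.unop
  map_id B := by
    ext A s
    exact congrArg Additive.ofMul (Category.id_comp s.toMul)
  map_comp b b' := by
    ext A s
    exact congrArg Additive.ofMul (Category.assoc b'.unop b.unop s.toMul)

/-- The presheaf of abelian groups `U ↦ Hom(L(U), A)` on `C` attached to a functor `L : C ⥤ F`,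
functorially in `A`. -/
def homPresheaf (L : C ⥤ F) : CommGrp F ⥤ Cᵒᵖ ⥤ AddCommGrpCat.{w} :=
  (L.op ⋙ homBifunctor F).flip

instance (L : C ⥤ F) : (homPresheaf L).Additive where
  map_add := by
    intros
    ext U : 2
    exact (homFunctor (L.obj U.unop)).map_add

/-- `homEquivSections` as an isomorphism of abelian groups. -/
noncomputable def homAddEquivSections (A : CommGrp F) (U : Cᵒᵖ) :
    ((homPresheaf (canonicalFunctor J ⋙ f.inverseImage)).obj A).obj U ≃+
      (abPresheafObj (f.abDirectImage.obj A)).obj U where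
  toFun s := homEquivSections f U.unop A.X s.toMul
  invFun s := Additive.ofMul ((homEquivSections f U.unop A.X).symm s)
  left_inv s := (homEquivSections f U.unop A.X).symm_apply_apply s.toMul
  right_inv s := (homEquivSections f U.unop A.X).apply_symm_apply s
  map_add' s t := homEquivSections_mul f U.unop A s.toMul t.toMul

/-- The presheaf `U ↦ Hom(f^* l(U), A)` is the sheaf of abelian groups `f_* A`. -/
noncomputable def sectionsIso :
    homPresheaf (canonicalFunctor J ⋙ f.inverseImage) ≅
      f.abDirectImage ⋙ toAbSheaf J ⋙ sheafToPresheaf J AddCommGrpCat.{w} :=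
  NatIso.ofComponents (fun A => NatIso.ofComponents
      (F := (homPresheaf (canonicalFunctor J ⋙ f.inverseImage)).obj A)
      (G := abPresheafObj (f.abDirectImage.obj A))
      (fun U => (homAddEquivSections f A U).toAddCommGrpIso)
      (fun i => by
        ext s
        exact homEquivSections_precomp f i.unop s.toMul))
    (fun φ => by
      ext U s
      exact homEquivSections_comp f U.unop s.toMul φ.hom.hom.hom)

/-- The `q`-th right derived functor of `A ↦ (U ↦ Hom(L(U), A))`, taken in presheaves of abelian
groups, is `A ↦ (U ↦ H^q(F, L(U); A))`: kernels and cokernels of presheaves are computed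
objectwise. -/
noncomputable def rightDerivedHomPresheaf [IsGrothendieckTopos F] (L : C ⥤ F) (q : ℕ) :
    (homPresheaf L).rightDerived q ≅ (L.op ⋙ cohomology F q).flip :=
  -- `homPresheaf L ⋙ (evaluation _ _).obj U` is `homFunctor (L.obj U.unop)` by definition.
  letI e (U : Cᵒᵖ) := rightDerivedCompIso (homPresheaf L) ((evaluation _ AddCommGrpCat.{w}).obj U) q
  NatIso.ofComponents
    (fun A => NatIso.ofComponents (fun U => ((e U).app A).symm) (fun {U V} i => by
      have h := NatTrans.congr_app (rightDerivedCompIso_hom_whiskerLeft (homPresheaf L)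
        ((evaluation _ AddCommGrpCat.{w}).map i) q) A
      exact (CommSq.horiz_inv (f := (e U).app A) (i := (e V).app A) ⟨h.symm⟩).w.symm))
    (fun φ => by
      ext U : 2
      exact (e U).inv.naturality φ)

end SectionsOfDirectImage

end ToposCohomology

/-- `R^q f_* A` is the `J`-sheaf associated to the presheaf `U ↦ H^q(F, f^* l(U); A)`,
naturally in `A` in `Ab(F)`. -/
theorem mainTheorem9 {C : Type w} [SmallCategory C] (J : GrothendieckTopology C)
    {F : Type u} [Category.{w} F] [CartesianMonoidalCategory F] [BraidedCategory F]
    [IsGrothendieckTopos F] (f : GeometricMorphism F (Sheaf J (Type w))) (q : ℕ) :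
    Nonempty (f.higherDirectImage q ⋙ toAbSheaf J ≅
      f.cohomologyPresheaf q ⋙ presheafToSheaf J AddCommGrpCat.{w}) := by
  -- `f_* A` is a sheaf, hence the sheafification of its underlying presheaf.
  let e : f.abDirectImage ⋙ toAbSheaf J ≅
      homPresheaf (canonicalFunctor J ⋙ f.inverseImage) ⋙ presheafToSheaf J AddCommGrpCat.{w} :=
    Functor.isoWhiskerLeft (f.abDirectImage ⋙ toAbSheaf J)
      (sheafificationNatIso J AddCommGrpCat.{w}) ≪≫
      Functor.isoWhiskerRight (sectionsIso f).symm (presheafToSheaf J AddCommGrpCat.{w})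
  exact ⟨(rightDerivedCompIso f.abDirectImage (toAbSheaf J) q).symm ≪≫ rightDerivedCongr e q ≪≫
    rightDerivedCompIso _ (presheafToSheaf J AddCommGrpCat.{w}) q ≪≫
    Functor.isoWhiskerRight (rightDerivedHomPresheaf _ q) _⟩
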